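/- A permutation $\pi=\pi_1\pi_2\cdots\pi_m$ of $\{1,\dots,m\}$ is alternating if $\pi_1<\pi_2>\pi_3<\pi_4>\cdots$. It contains a pattern $\sigma=\sigma_1\cdots\sigma_k$ (a permutation of $\{1,\dots,k\}$) if there are indices $1\le i_1<\cdots<i_k\le m$ such that, for all $l,r\in\{1,\dots,k\}$, $\pi_{i_l}<\pi_{i_r}$ if and only if $\sigma_l<\sigma_r$; otherwise it avoids $\sigma$. Let $A_m(\sigma)$ be the set of alternating permutations of $\{1,\dots,m\}$ that avoid $\sigma$. Then for every integer $n\ge 0$, $$|A_{2n+1}(1243)|=|A_{2n+1}(2143)|.$$ -/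

import Mathlib

/-- `π = π₁π₂⋯πₙ` is alternating (up-down): `π₁ < π₂ > π₃ < π₄ > ⋯`. Positions are indexed from
`0` here, so ascents are at even indices and descents at odd indices. -/
def IsAlternating {n : ℕ} (π : Equiv.Perm (Fin n)) : Prop :=
  ∀ i j : Fin n, (j : ℕ) = (i : ℕ) + 1 →
    (Even (i : ℕ) → π i < π j) ∧ (Odd (i : ℕ) → π j < π i)

/-- `π` contains the pattern `σ`, a permutation of `1, …, k` written as the word `σ₁σ₂⋯σₖ`:
some subsequence of `π`, at increasing positions `p 0 < p 1 < ⋯`, is order isomorphic to `σ`. -/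
def ContainsPattern {n k : ℕ} (π : Equiv.Perm (Fin n)) (σ : Fin k → ℕ) : Prop :=
  ∃ p : Fin k → Fin n, StrictMono p ∧ ∀ l m : Fin k, π (p l) < π (p m) ↔ σ l < σ m

/-- The set `Aₙ(σ)` of alternating permutations of length `n` that avoid the pattern `σ`. -/
def alternatingAvoiding {k : ℕ} (n : ℕ) (σ : Fin k → ℕ) : Set (Equiv.Perm (Fin n)) :=
  {π | IsAlternating π ∧ ¬ ContainsPattern π σ}

open Finset

/-! Both classes grow by the same generating tree. An alternating permutation of odd length is
obtained from one, `f`, two shorter by prepending letters `a`, `b`. Give `f` the label `(c, m)`,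
with `c = inversionBound f` and `m` equal to `bound132 f` for 1243, `siteDefect f` for 2143. In both
classes `b` is admissible iff `c ≤ b`, and for fixed `b` the children have labels `(b + 1, k)`, each
`k` in `[m, b]` occurring once. For 1243, `a` ranges over `[m, b]` and `k` is a cyclic shift of `a`
(`bijOn_ite_succ`). For 2143, `a` ranges over the sites up to `b`, and `k` is `b + 1` minus the rank
of `a` among them (`bijOn_card_sitesUpTo`). The common recursion is
`sum_filter_prependLetter_prependLetter`; induction with arbitrary weights on labels concludes. -/

/-- The value that `x` takes after a new letter of value `s` has been inserted. -/
def shiftAt (s x : ℕ) : ℕ := if x < s then x else x + 1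

lemma shiftAt_of_lt {s x : ℕ} (h : x < s) : shiftAt s x = x := if_pos h

lemma val_succAbove_eq_shiftAt {n : ℕ} (s : Fin (n + 1)) (x : Fin n) :
    (s.succAbove x : ℕ) = shiftAt s x := by
  unfold shiftAt Fin.succAbove
  simp only [Fin.lt_def, Fin.val_castSucc]
  split_ifs <;> simp

lemma lt_succAbove_iff_val {n : ℕ} (s : Fin (n + 1)) (x : Fin n) :
    s < s.succAbove x ↔ (s : ℕ) ≤ x := by
  rw [Fin.lt_def, val_succAbove_eq_shiftAt, shiftAt]; split_ifs <;> omega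

lemma succAbove_lt_iff_val {n : ℕ} (s : Fin (n + 1)) (x : Fin n) :
    s.succAbove x < s ↔ (x : ℕ) < s := by
  rw [Fin.lt_def, val_succAbove_eq_shiftAt, shiftAt]; split_ifs <;> omega

/-- Prepend the letter `s` to the word of `f`, raising the letters that are at least `s`. -/
noncomputable def prependLetter {n : ℕ} (s : Fin (n + 1)) (f : Equiv.Perm (Fin n)) :
    Equiv.Perm (Fin (n + 1)) :=
  Equiv.ofBijective (Fin.cons s fun i => s.succAbove (f i)) <| by
    rw [← Finite.injective_iff_bijective, Fin.cons_injective_iff]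
    refine ⟨?_, Fin.succAbove_right_injective.comp f.injective⟩
    rintro ⟨i, hi⟩
    exact Fin.succAbove_ne _ _ hi

@[simp] lemma prependLetter_zero {n : ℕ} (s : Fin (n + 1)) (f : Equiv.Perm (Fin n)) :
    prependLetter s f 0 = s := rfl

@[simp] lemma prependLetter_succ {n : ℕ} (s : Fin (n + 1)) (f : Equiv.Perm (Fin n)) (i : Fin n) :
    prependLetter s f i.succ = s.succAbove (f i) := rfl

lemma prependLetter_bijective (n : ℕ) :
    Function.Bijective fun p : Fin (n + 1) × Equiv.Perm (Fin n) => prependLetter p.1 p.2 := by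
  rw [Fintype.bijective_iff_injective_and_card]
  constructor
  · rintro ⟨s, f⟩ ⟨t, g⟩ h
    have h0 : s = t := by simpa using congrArg (fun e => e 0) h
    subst h0
    congr 1
    ext i
    have := congrArg (fun e => e i.succ) h
    exact congrArg Fin.val (by simpa using this)
  · simp [Fintype.card_perm, Nat.factorial_succ]

/-! ### Pattern conditions relative to a threshold value -/

/-- No inversion of `f` has its smaller letter at least `s`. -/
def NoInversionAbove {n : ℕ} (f : Equiv.Perm (Fin n)) (s : ℕ) : Prop :=
  ∀ i j, i < j → f j < f i → (f j : ℕ) < s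

/-- No occurrence of `132` in `f` has its smallest letter at least `s`. -/
def No132Above {n : ℕ} (f : Equiv.Perm (Fin n)) (s : ℕ) : Prop :=
  ∀ i j k, i < j → j < k → f i < f k → f k < f j → (f i : ℕ) < s

/-- No occurrence of `132` in `f` has its two smaller letters separated by `s`. -/
def No132Across {n : ℕ} (f : Equiv.Perm (Fin n)) (s : ℕ) : Prop :=
  ∀ i j k, i < j → j < k → f i < f k → f k < f j → (f i : ℕ) < s → (f k : ℕ) < s

/-- `f` avoids `1243`. -/
def Avoids1243 {n : ℕ} (f : Equiv.Perm (Fin n)) : Prop :=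
  ∀ i j k l, i < j → j < k → k < l → f i < f j → f j < f l → ¬ f l < f k

/-- `f` avoids `2143`. -/
def Avoids2143 {n : ℕ} (f : Equiv.Perm (Fin n)) : Prop :=
  ∀ i j k l, i < j → j < k → k < l → f j < f i → f i < f l → ¬ f l < f k

lemma strictMono_vec4 {n : ℕ} {i j k l : Fin n} (hij : i < j) (hjk : j < k) (hkl : k < l) :
    StrictMono ![i, j, k, l] := by
  rw [Fin.strictMono_iff_lt_succ]
  intro x
  fin_cases x <;> simpa

lemma not_containsPattern_1243_iff {n : ℕ} (f : Equiv.Perm (Fin n)) :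
    ¬ ContainsPattern f ![1, 2, 4, 3] ↔ Avoids1243 f := by
  constructor
  · intro h i j k l hij hjk hkl h1 h2 h3
    refine h ⟨![i, j, k, l], strictMono_vec4 hij hjk hkl, ?_⟩
    intro x y
    fin_cases x <;> fin_cases y <;> simp <;> order
  · rintro h ⟨p, hp, hq⟩
    refine h (p 0) (p 1) (p 2) (p 3) (hp (by decide)) (hp (by decide)) (hp (by decide)) ?_ ?_ ?_
    all_goals rw [hq]; simp

lemma not_containsPattern_2143_iff {n : ℕ} (f : Equiv.Perm (Fin n)) :
    ¬ ContainsPattern f ![2, 1, 4, 3] ↔ Avoids2143 f := by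
  constructor
  · intro h i j k l hij hjk hkl h1 h2 h3
    refine h ⟨![i, j, k, l], strictMono_vec4 hij hjk hkl, ?_⟩
    intro x y
    fin_cases x <;> fin_cases y <;> simp <;> order
  · rintro h ⟨p, hp, hq⟩
    refine h (p 0) (p 1) (p 2) (p 3) (hp (by decide)) (hp (by decide)) (hp (by decide)) ?_ ?_ ?_
    all_goals rw [hq]; simp

section Prepend

variable {n : ℕ} (s : Fin (n + 1)) (f : Equiv.Perm (Fin n))

lemma avoids1243_prependLetter :
    Avoids1243 (prependLetter s f) ↔ No132Above f s ∧ Avoids1243 f := by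
  simp only [Avoids1243, No132Above, Fin.forall_fin_succ, prependLetter_zero, prependLetter_succ,
    Fin.succ_lt_succ_iff, Fin.succ_pos, Fin.not_lt_zero, IsEmpty.forall_iff,
    implies_true, true_and, forall_const, lt_succAbove_iff_val,
    Fin.succAbove_lt_succAbove_iff]
  refine and_congr_left fun _ => ?_
  refine forall_congr' fun i => forall_congr' fun j => forall_congr' fun k => ?_
  grind

lemma avoids2143_prependLetter :
    Avoids2143 (prependLetter s f) ↔ No132Across f s ∧ Avoids2143 f := by
  simp only [Avoids2143, No132Across, Fin.forall_fin_succ, prependLetter_zero, prependLetter_succ,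
    Fin.succ_lt_succ_iff, Fin.succ_pos, Fin.not_lt_zero, IsEmpty.forall_iff,
    implies_true, true_and, forall_const, lt_succAbove_iff_val, succAbove_lt_iff_val,
    Fin.succAbove_lt_succAbove_iff]
  refine and_congr_left fun _ => ?_
  refine forall_congr' fun i => forall_congr' fun j => forall_congr' fun k => ?_
  grind

lemma noInversionAbove_prependLetter (t : ℕ) :
    NoInversionAbove (prependLetter s f) t ↔ (∀ j, (f j : ℕ) < s → (f j : ℕ) < t) ∧
      ∀ i j, i < j → f j < f i → shiftAt s (f j) < t := by
  simp only [NoInversionAbove, Fin.forall_fin_succ, prependLetter_zero, prependLetter_succ,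
    Fin.succ_lt_succ_iff, Fin.succ_pos, Fin.not_lt_zero, IsEmpty.forall_iff,
    true_and, forall_const, succAbove_lt_iff_val,
    Fin.succAbove_lt_succAbove_iff, val_succAbove_eq_shiftAt]
  refine and_congr_left fun _ => forall_congr' fun i => forall_congr' fun h => ?_
  rw [shiftAt_of_lt h]

lemma no132Above_prependLetter (t : ℕ) :
    No132Above (prependLetter s f) t ↔
      (∀ j k, j < k → f k < f j → (s : ℕ) ≤ f k → (s : ℕ) < t) ∧
      ∀ i j k, i < j → j < k → f i < f k → f k < f j → shiftAt s (f i) < t := by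
  simp only [No132Above, Fin.forall_fin_succ, prependLetter_zero, prependLetter_succ,
    Fin.succ_lt_succ_iff, Fin.succ_pos, Fin.not_lt_zero, IsEmpty.forall_iff,
    implies_true, true_and, forall_const, lt_succAbove_iff_val,
    Fin.succAbove_lt_succAbove_iff, val_succAbove_eq_shiftAt]
  refine and_congr_left fun _ => forall_congr' fun i => forall_congr' fun j => ?_
  tauto

lemma no132Across_prependLetter (t : ℕ) :
    No132Across (prependLetter s f) t ↔
      (∀ j k, j < k → f k < f j → (s : ℕ) ≤ f k → (s : ℕ) < t → shiftAt s (f k) < t) ∧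
      ∀ i j k, i < j → j < k → f i < f k → f k < f j → shiftAt s (f i) < t →
        shiftAt s (f k) < t := by
  simp only [No132Across, Fin.forall_fin_succ, prependLetter_zero, prependLetter_succ,
    Fin.succ_lt_succ_iff, Fin.succ_pos, Fin.not_lt_zero, IsEmpty.forall_iff,
    implies_true, true_and, forall_const, lt_succAbove_iff_val,
    Fin.succAbove_lt_succAbove_iff, val_succAbove_eq_shiftAt]
  refine and_congr_left fun _ => forall_congr' fun i => forall_congr' fun j => ?_
  tauto

end Prepend

lemma isAlternating_prependLetter_prependLetter {n : ℕ} (a : Fin (n + 3)) (b : Fin (n + 2))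
    (f : Equiv.Perm (Fin (n + 1))) :
    IsAlternating (prependLetter a (prependLetter b f)) ↔
      (a : ℕ) ≤ b ∧ (f 0 : ℕ) < b ∧ IsAlternating f := by
  constructor
  · intro h
    refine ⟨?_, ?_, ?_⟩
    · have := (h 0 (Fin.succ 0) (by simp)).1 (by simp)
      simpa only [prependLetter_succ, prependLetter_zero, lt_succAbove_iff_val] using this
    · have := (h (Fin.succ 0) (Fin.succ (Fin.succ 0)) (by simp)).2 (by simp)
      simpa only [prependLetter_succ, prependLetter_zero, Fin.succAbove_lt_succAbove_iff,
        succAbove_lt_iff_val] using this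
    · intro i j hij
      have := h i.succ.succ j.succ.succ (by simp [hij])
      simpa [prependLetter_succ, Fin.succAbove_lt_succAbove_iff, Nat.even_add_one,
        Nat.odd_add_one] using this
  · rintro ⟨h1, h2, h3⟩ i j hij
    induction j using Fin.cases with
    | zero => simp at hij
    | succ j =>
    induction i using Fin.cases with
    | zero =>
      have hj : j = 0 := by ext; simpa using hij
      subst hj
      exact ⟨fun _ => (lt_succAbove_iff_val _ _).2 h1, fun h => by simp at h⟩
    | succ i =>
    simp only [Fin.val_succ, Nat.add_right_cancel_iff] at hij
    induction j using Fin.cases with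
    | zero => simp at hij
    | succ j =>
    induction i using Fin.cases with
    | zero =>
      have hj : j = 0 := by ext; simpa using hij
      subst hj
      exact ⟨fun h => by simp at h,
        fun _ => Fin.succAbove_lt_succAbove_iff.2 ((succAbove_lt_iff_val _ _).2 h2)⟩
    | succ i =>
      have := h3 i j (by simpa using hij)
      simpa [prependLetter_succ, Fin.succAbove_lt_succAbove_iff, Nat.even_add_one,
        Nat.odd_add_one] using this

/-! ### Labels, and their change under prepending two letters -/

lemma nat_sInf_le_iff_mem {U : Set ℕ} (hne : U.Nonempty) (hU : IsUpperSet U) (s : ℕ) :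
    sInf U ≤ s ↔ s ∈ U :=
  ⟨fun h => hU h (Nat.sInf_mem hne), fun h => Nat.sInf_le h⟩

/-- The least value exceeding the first letter and the smaller letter of every inversion. -/
noncomputable def inversionBound {n : ℕ} (f : Equiv.Perm (Fin (n + 1))) : ℕ :=
  sInf {s | (f 0 : ℕ) < s ∧ NoInversionAbove f s}

/-- The least value exceeding the smallest letter of every occurrence of `132`. -/
noncomputable def bound132 {n : ℕ} (f : Equiv.Perm (Fin n)) : ℕ :=
  sInf {s | No132Above f s}

lemma inversionBound_le_iff {n : ℕ} (f : Equiv.Perm (Fin (n + 1))) (s : ℕ) :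
    inversionBound f ≤ s ↔ (f 0 : ℕ) < s ∧ NoInversionAbove f s :=
  nat_sInf_le_iff_mem (U := {s | (f 0 : ℕ) < s ∧ NoInversionAbove f s})
    ⟨n + 1, (f 0).2, fun _ j _ _ => (f j).2⟩
    (fun _ _ hst h => ⟨h.1.trans_le hst, fun i j hij hf => (h.2 i j hij hf).trans_le hst⟩) s

lemma bound132_le_iff {n : ℕ} (f : Equiv.Perm (Fin n)) (s : ℕ) :
    bound132 f ≤ s ↔ No132Above f s :=
  nat_sInf_le_iff_mem (U := {s | No132Above f s}) ⟨n, fun i _ _ _ _ _ _ => (f i).2⟩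
    (fun _ _ hst h i j k hij hjk h1 h2 => (h i j k hij hjk h1 h2).trans_le hst) s

lemma exists_perm_val_eq {n : ℕ} (f : Equiv.Perm (Fin n)) {y : ℕ} (hy : y < n) :
    ∃ j, (f j : ℕ) = y :=
  ⟨f.symm ⟨y, hy⟩, by simp⟩

section PrependTwo

variable {n : ℕ} {a : Fin (n + 3)} {b : Fin (n + 2)} {f : Equiv.Perm (Fin (n + 1))}

lemma inversionBound_prependLetter_prependLetter (hb : inversionBound f ≤ b) (hab : (a : ℕ) ≤ b) :
    inversionBound (prependLetter a (prependLetter b f)) = b + 1 := by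
  refine eq_of_forall_ge_iff fun s => ?_
  rw [inversionBound_le_iff] at hb ⊢
  obtain ⟨h0, hI⟩ := hb
  rw [noInversionAbove_prependLetter, prependLetter_zero]
  simp only [Fin.forall_fin_succ (n := n + 1), prependLetter_zero, prependLetter_succ,
    Fin.succ_lt_succ_iff, Fin.succ_pos, Fin.not_lt_zero, IsEmpty.forall_iff,
    true_and, forall_const, succAbove_lt_iff_val,
    Fin.succAbove_lt_succAbove_iff, val_succAbove_eq_shiftAt]
  constructor
  · rintro ⟨h1, -, h2, -⟩
    rcases hab.lt_or_eq with h | h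
    · obtain ⟨j, hj⟩ := exists_perm_val_eq f (y := b - 1) (by omega)
      have := h2 j (by omega)
      unfold shiftAt at this
      grind
    · omega
  · intro hs
    refine ⟨by omega, ⟨by omega, fun i hi => by omega⟩, fun i hi => ?_, fun i j hij hf => ?_⟩
    · unfold shiftAt; grind
    · have := hI i j hij hf
      unfold shiftAt; grind

/-- If `a < b`, then `a`, `b + 1`, `b` form a 132 whose smallest letter `a` is at least `bound132
f`; if `a = b`, no relevant 132 is created. -/
lemma bound132_prependLetter_prependLetter (hb : inversionBound f ≤ b) (hab : (a : ℕ) ≤ b)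
    (ha : bound132 f ≤ a) :
    bound132 (prependLetter a (prependLetter b f)) =
      if (a : ℕ) = b then bound132 f else a + 1 := by
  refine eq_of_forall_ge_iff fun s => ?_
  rw [inversionBound_le_iff] at hb
  obtain ⟨h0, hI⟩ := hb
  have key : No132Above (prependLetter a (prependLetter b f)) s ↔
      ((a : ℕ) < b → (a : ℕ) < s) ∧ No132Above f s := by
    have ha' := (bound132_le_iff f a).1 ha
    rw [no132Above_prependLetter]
    simp only [Fin.forall_fin_succ (n := n + 1), prependLetter_zero, prependLetter_succ,
      Fin.succ_lt_succ_iff, Fin.succ_pos, Fin.not_lt_zero, IsEmpty.forall_iff,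
      implies_true, true_and, forall_const, succAbove_lt_iff_val, lt_succAbove_iff_val,
      Fin.succAbove_lt_succAbove_iff, val_succAbove_eq_shiftAt]
    constructor
    · rintro ⟨⟨h1, -⟩, -, h2⟩
      refine ⟨fun h => ?_, fun i j k hij hjk hik hkj => ?_⟩
      · obtain ⟨j, hj⟩ := exists_perm_val_eq f (y := b - 1) (by omega)
        exact h1 j (by omega) (by unfold shiftAt; grind)
      · have := h2 i j k hij hjk hik hkj
        unfold shiftAt at this; grind
    · rintro ⟨h1, h2⟩
      refine ⟨⟨fun i hi hi' => h1 ?_, fun i j hij hf h => h1 ?_⟩, fun i j hij hf h => ?_,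
        fun i j k hij hjk hik hkj => ?_⟩
      · unfold shiftAt at hi'; grind
      · have := hI i j hij hf
        unfold shiftAt at h; grind
      · have := hI i j hij h
        omega
      · have h3 := h2 i j k hij hjk hik hkj
        have h4 := ha' i j k hij hjk hik hkj
        have h5 := hI j k hjk hkj
        rw [Fin.lt_def] at hik
        unfold shiftAt; grind
  rw [bound132_le_iff, key, ← bound132_le_iff]
  split_ifs <;> omega

/-- With `a`, `b` playing 12, an inversion of `f` above `b` would complete 1243; this gives the
bound on `b`. -/
lemma isAlternating_and_avoids1243_prependLetter_prependLetter :
    (IsAlternating (prependLetter a (prependLetter b f)) ∧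
        Avoids1243 (prependLetter a (prependLetter b f))) ↔
      (IsAlternating f ∧ Avoids1243 f) ∧ inversionBound f ≤ b ∧
        (a : ℕ) ∈ Icc (bound132 f) (b : ℕ) := by
  rw [isAlternating_prependLetter_prependLetter, avoids1243_prependLetter,
    avoids1243_prependLetter, no132Above_prependLetter, mem_Icc, inversionBound_le_iff,
    bound132_le_iff]
  constructor
  · rintro ⟨⟨hab, h0, hf⟩, ⟨h1, h2⟩, h3, h4⟩
    refine ⟨⟨hf, h4⟩, ⟨h0, fun i j hij hji => ?_⟩, fun i j k hij hjk hik hkj => ?_, hab⟩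
    · by_contra! h
      have := h1 i j hij hji h
      omega
    · have := h2 i j k hij hjk hik hkj
      unfold shiftAt at this; grind
  · rintro ⟨⟨hf, h4⟩, ⟨h0, hI⟩, h1, hab⟩
    refine ⟨⟨hab, h0, hf⟩, ⟨fun i j hij hji h => ?_, fun i j k hij hjk hik hkj => ?_⟩,
      fun i j k hij hjk hik hkj => ?_, h4⟩
    · have := hI i j hij hji
      omega
    · have := h1 i j k hij hjk hik hkj
      unfold shiftAt; grind
    · have := hI j k hjk hkj
      rw [Fin.lt_def] at hik
      omega

lemma no132Across_iff_noInversionAbove {s : ℕ} (h : (f 0 : ℕ) < s) :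
    No132Across f s ↔ NoInversionAbove f s := by
  constructor
  · intro hA i j hij hji
    by_contra! hs
    have hi : i ≠ 0 := by
      rintro rfl
      rw [Fin.lt_def] at hji
      omega
    -- The first letter, below `s`, turns an inversion above `s` into a 132 separated by `s`.
    have := hA 0 i j (Fin.pos_iff_ne_zero.2 hi) hij (by rw [Fin.lt_def]; omega) hji h
    omega
  · intro hI i j k _ hjk _ hkj _
    exact hI j k hjk hkj

/-- Every inversion of `f` has its smaller letter below `b`, so `b` starts no 132 and the two
smaller letters of an old 132 do not move. -/
lemma no132Across_prependLetter_iff {s : ℕ} (hb : inversionBound f ≤ b) :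
    No132Across (prependLetter b f) s ↔ No132Across f s := by
  rw [inversionBound_le_iff] at hb
  obtain ⟨h0, hI⟩ := hb
  rw [no132Across_prependLetter]
  have h1 : ∀ j k, j < k → f k < f j → (b : ℕ) ≤ f k → (b : ℕ) < s → shiftAt b (f k) < s := by
    intro j k hjk hkj h
    have := hI j k hjk hkj
    omega
  rw [and_iff_right h1]
  refine forall_congr' fun i => forall_congr' fun j => forall_congr' fun k =>
    forall_congr' fun hij => forall_congr' fun hjk => forall_congr' fun hik =>
    forall_congr' fun hkj => ?_
  have := hI j k hjk hkj
  rw [Fin.lt_def] at hik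
  rw [shiftAt_of_lt this, shiftAt_of_lt (by omega)]

lemma no132Across_prependLetter_of_le {n : ℕ} {a : Fin (n + 1)} {f : Equiv.Perm (Fin n)} {s : ℕ}
    (hs : s ≤ a) : No132Across (prependLetter a f) s ↔ No132Across f s := by
  rw [no132Across_prependLetter]
  have h1 : ∀ j k, j < k → f k < f j → (a : ℕ) ≤ f k → (a : ℕ) < s → shiftAt a (f k) < s := by
    intros; omega
  have h2 (x : ℕ) : shiftAt a x < s ↔ x < s := by
    unfold shiftAt; split_ifs <;> omega
  rw [and_iff_right h1]
  simp only [h2]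
  rfl

open Classical in
/-- The values up to `t` that separate no occurrence of `132` in `f`. -/
noncomputable def sitesUpTo {n : ℕ} (f : Equiv.Perm (Fin n)) (t : ℕ) : Finset ℕ :=
  {s ∈ range (t + 1) | No132Across f s}

lemma mem_sitesUpTo {n : ℕ} {f : Equiv.Perm (Fin n)} {t s : ℕ} :
    s ∈ sitesUpTo f t ↔ s ≤ t ∧ No132Across f s := by
  simp [sitesUpTo]

/-- The value `inversionBound f` diminished by the number of sites up to the first letter. -/
noncomputable def siteDefect {n : ℕ} (f : Equiv.Perm (Fin (n + 1))) : ℕ :=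
  inversionBound f - #(sitesUpTo f (f 0))

lemma siteDefect_prependLetter_prependLetter (hb : inversionBound f ≤ b) (hab : (a : ℕ) ≤ b) :
    siteDefect (prependLetter a (prependLetter b f)) = b + 1 - #(sitesUpTo f a) := by
  rw [siteDefect, inversionBound_prependLetter_prependLetter hb hab, prependLetter_zero]
  congr 2
  ext s
  simp only [mem_sitesUpTo]
  refine and_congr_right fun hs => ?_
  rw [no132Across_prependLetter_of_le hs, no132Across_prependLetter_iff hb]

lemma isAlternating_and_avoids2143_prependLetter_prependLetter :
    (IsAlternating (prependLetter a (prependLetter b f)) ∧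
        Avoids2143 (prependLetter a (prependLetter b f))) ↔
      (IsAlternating f ∧ Avoids2143 f) ∧ inversionBound f ≤ b ∧
        (a : ℕ) ∈ sitesUpTo f b := by
  rw [isAlternating_prependLetter_prependLetter, avoids2143_prependLetter,
    avoids2143_prependLetter, mem_sitesUpTo]
  constructor
  · rintro ⟨⟨hab, h0, hf⟩, h1, h2, h3⟩
    have hb : inversionBound f ≤ b :=
      (inversionBound_le_iff f b).2 ⟨h0, (no132Across_iff_noInversionAbove h0).1 h2⟩
    exact ⟨⟨hf, h3⟩, hb, hab, (no132Across_prependLetter_iff hb).1 h1⟩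
  · rintro ⟨⟨hf, h3⟩, hb, hab, h1⟩
    have hb' := (inversionBound_le_iff f b).1 hb
    exact ⟨⟨hab, hb'.1, hf⟩, (no132Across_prependLetter_iff hb).2 h1,
      (no132Across_iff_noInversionAbove hb'.1).2 hb'.2, h3⟩

end PrependTwo

/-! ### Counting sites and the bijections onto label intervals -/

lemma card_sitesUpTo_le {n : ℕ} (f : Equiv.Perm (Fin n)) (t : ℕ) : #(sitesUpTo f t) ≤ t + 1 := by
  classical
  simpa [sitesUpTo] using card_filter_le (range (t + 1)) (No132Across f)

/-- Above the first letter, the sites are exactly the values at least `inversionBound f`. -/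
lemma card_sitesUpTo_of_inversionBound_le {n : ℕ} {f : Equiv.Perm (Fin (n + 1))} {b : ℕ}
    (hb : inversionBound f ≤ b) :
    #(sitesUpTo f b) = #(sitesUpTo f (f 0)) + (b + 1 - inversionBound f) := by
  have h0 := ((inversionBound_le_iff f _).1 le_rfl).1
  rw [← Nat.card_Icc, ← card_union_of_disjoint]
  · congr 1
    ext s
    simp only [mem_union, mem_sitesUpTo, mem_Icc]
    by_cases hs : (f 0 : ℕ) < s
    · rw [inversionBound_le_iff, no132Across_iff_noInversionAbove hs]
      constructor
      · rintro ⟨h1, h2⟩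
        exact Or.inr ⟨⟨hs, h2⟩, h1⟩
      · rintro (⟨h1, h2⟩ | ⟨⟨h1, h2⟩, h3⟩)
        · omega
        · exact ⟨h3, h2⟩
    · constructor
      · rintro ⟨h1, h2⟩
        exact Or.inl ⟨by omega, h2⟩
      · rintro (⟨h1, h2⟩ | ⟨h1, h2⟩)
        · exact ⟨by omega, h2⟩
        · omega
  · rw [disjoint_left]
    intro s hs hs'
    rw [mem_sitesUpTo] at hs
    rw [mem_Icc] at hs'
    omega

lemma bijOn_card_sitesUpTo {n : ℕ} {f : Equiv.Perm (Fin (n + 1))} {b : ℕ}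
    (hb : inversionBound f ≤ b) :
    Set.BijOn (fun a => b + 1 - #(sitesUpTo f a)) (sitesUpTo f b) (Icc (siteDefect f) b) := by
  have hcard := card_sitesUpTo_of_inversionBound_le hb
  have h0 := ((inversionBound_le_iff f _).1 le_rfl).1
  have hle := card_sitesUpTo_le f (f 0)
  have hleb := card_sitesUpTo_le f b
  have hmono : ∀ s t, s ≤ t → #(sitesUpTo f s) ≤ #(sitesUpTo f t) := fun s t hst =>
    card_le_card fun x hx => by
      rw [mem_sitesUpTo] at hx ⊢
      exact ⟨hx.1.trans hst, hx.2⟩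
  have hmaps : Set.MapsTo (fun a => b + 1 - #(sitesUpTo f a)) (sitesUpTo f b)
      (Icc (siteDefect f) b) := by
    intro a ha
    rw [mem_coe, mem_sitesUpTo] at ha
    have h1 := hmono a b ha.1
    -- The site `a` counts itself, so the image is at most `b`.
    have h2 : 0 < #(sitesUpTo f a) := card_pos.2 ⟨a, mem_sitesUpTo.2 ⟨le_rfl, ha.2⟩⟩
    simp only [coe_Icc, Set.mem_Icc, siteDefect]
    omega
  have hinj : Set.InjOn (fun a => b + 1 - #(sitesUpTo f a)) (sitesUpTo f b) := by
    have hlt : ∀ s t, s < t → t ∈ sitesUpTo f b →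
        b + 1 - #(sitesUpTo f t) < b + 1 - #(sitesUpTo f s) := by
      intro s t hst ht
      rw [mem_sitesUpTo] at ht
      have h1 := hmono t b ht.1
      have : #(sitesUpTo f s) < #(sitesUpTo f t) := by
        refine card_lt_card (ssubset_iff_of_subset ?_ |>.2 ⟨t, mem_sitesUpTo.2 ⟨le_rfl, ht.2⟩, ?_⟩)
        · intro x hx
          rw [mem_sitesUpTo] at hx ⊢
          exact ⟨hx.1.trans hst.le, hx.2⟩
        · rw [mem_sitesUpTo]
          omega
      omega
    intro s hs t ht h
    rcases lt_trichotomy s t with h' | h' | h'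
    · exact absurd h (hlt s t h' ht).ne'
    · exact h'
    · exact absurd h (hlt t s h' hs).ne
  refine ⟨hmaps, hinj, surjOn_of_injOn_of_card_le _ hmaps hinj ?_⟩
  rw [Nat.card_Icc, siteDefect]
  omega

lemma bijOn_ite_succ {m b : ℕ} (hm : m ≤ b) :
    Set.BijOn (fun a => if a = b then m else a + 1) (Icc m b) (Icc m b) := by
  have hmaps : Set.MapsTo (fun a => if a = b then m else a + 1) (Icc m b) (Icc m b) := by
    intro a ha
    simp only [coe_Icc, Set.mem_Icc] at ha ⊢
    split_ifs <;> omega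
  have hinj : Set.InjOn (fun a => if a = b then m else a + 1) (Icc m b) := by
    intro s hs t ht h
    simp only [coe_Icc, Set.mem_Icc] at hs ht h
    split_ifs at h <;> omega
  exact ⟨hmaps, hinj, surjOn_of_injOn_of_card_le _ hmaps hinj le_rfl⟩

lemma bound132_le_inversionBound {n : ℕ} (f : Equiv.Perm (Fin (n + 1))) :
    bound132 f ≤ inversionBound f := by
  have h := ((inversionBound_le_iff f _).1 le_rfl).2
  refine (bound132_le_iff f _).2 fun i j k _ hjk hik hkj => ?_
  exact (Fin.lt_def.1 hik).trans (h j k hjk hkj)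

/-! ### The common recursion and the induction -/

lemma sum_perm_eq_sum_prependLetter_prependLetter (n : ℕ) (F : Equiv.Perm (Fin (n + 2)) → ℕ) :
    ∑ g, F g = ∑ f : Equiv.Perm (Fin n), ∑ b : Fin (n + 1), ∑ a : Fin (n + 2),
      F (prependLetter a (prependLetter b f)) := by
  rw [← (prependLetter_bijective (n + 1)).sum_comp, Fintype.sum_prod_type_right,
    ← (prependLetter_bijective n).sum_comp, Fintype.sum_prod_type_right]

/-- The recursion for a label-weighted count, when prepending the two letters `a`, `b` is
controlled by a finite set of sites on which the new label is a bijection onto an interval. -/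
lemma sum_filter_prependLetter_prependLetter {n : ℕ}
    (S : Equiv.Perm (Fin (n + 1)) → Prop) (S' : Equiv.Perm (Fin (n + 3)) → Prop)
    [DecidablePred S] [DecidablePred S'] (m : Equiv.Perm (Fin (n + 1)) → ℕ) (m' : Equiv.Perm (Fin (n + 3)) → ℕ)
    (B : Equiv.Perm (Fin (n + 1)) → ℕ → Finset ℕ) (μ : Equiv.Perm (Fin (n + 1)) → ℕ → ℕ → ℕ)
    (hB : ∀ f b, ∀ a ∈ B f b, a ≤ b)
    (hS : ∀ (a : Fin (n + 3)) (b : Fin (n + 2)) f, S' (prependLetter a (prependLetter b f)) ↔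
      S f ∧ inversionBound f ≤ b ∧ (a : ℕ) ∈ B f b)
    (hm : ∀ (a : Fin (n + 3)) (b : Fin (n + 2)) f, inversionBound f ≤ b → (a : ℕ) ∈ B f b →
      m' (prependLetter a (prependLetter b f)) = μ f b a)
    (hμ : ∀ f b, inversionBound f ≤ b → Set.BijOn (μ f b) (B f b) (Icc (m f) b))
    (w : ℕ → ℕ → ℕ) :
    ∑ g with S' g, w (inversionBound g) (m' g) =
      ∑ f with S f, ∑ b ∈ Icc (inversionBound f) (n + 1), ∑ k ∈ Icc (m f) b, w (b + 1) k := by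
  rw [sum_filter, sum_perm_eq_sum_prependLetter_prependLetter, sum_filter]
  refine sum_congr rfl fun f _ => ?_
  have inner (b : Fin (n + 2)) : (∑ a : Fin (n + 3),
      if S' (prependLetter a (prependLetter b f)) then
        w (inversionBound (prependLetter a (prependLetter b f)))
          (m' (prependLetter a (prependLetter b f))) else 0) =
      if S f ∧ inversionBound f ≤ b then ∑ k ∈ Icc (m f) (b : ℕ), w (b + 1) k else 0 := by
    by_cases h : S f ∧ inversionBound f ≤ b
    · rw [if_pos h]
      have h1 (a : Fin (n + 3)) : (if S' (prependLetter a (prependLetter b f)) then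
          w (inversionBound (prependLetter a (prependLetter b f)))
            (m' (prependLetter a (prependLetter b f))) else 0) =
          if (a : ℕ) ∈ B f b then w (b + 1) (μ f b a) else 0 := by
        by_cases ha : (a : ℕ) ∈ B f b
        · rw [if_pos ((hS a b f).2 ⟨h.1, h.2, ha⟩), if_pos ha, hm a b f h.2 ha,
            inversionBound_prependLetter_prependLetter h.2 (hB _ _ _ ha)]
        · rw [if_neg ha, if_neg fun h' => ha ((hS a b f).1 h').2.2]
      simp only [h1]
      rw [Fin.sum_univ_eq_sum_range (fun a => if a ∈ B f b then w (b + 1) (μ f b a) else 0),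
        ← sum_filter, filter_mem_eq_inter, inter_eq_right.2]
      · exact sum_nbij (μ f b) (hμ f b h.2).mapsTo (hμ f b h.2).injOn (hμ f b h.2).surjOn
          fun _ _ => rfl
      · intro a ha
        have := hB f b a ha
        rw [mem_range]
        omega
    · rw [if_neg h]
      exact sum_eq_zero fun a _ => if_neg fun h' => h ⟨((hS a b f).1 h').1, ((hS a b f).1 h').2.1⟩
  simp only [inner]
  rw [Fin.sum_univ_eq_sum_range
    (fun b => if S f ∧ inversionBound f ≤ b then ∑ k ∈ Icc (m f) b, w (b + 1) k else 0)]
  by_cases h : S f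
  · simp only [h, true_and, if_true]
    rw [← sum_filter]
    refine sum_congr ?_ fun _ _ => rfl
    ext b
    simp only [mem_filter, mem_range, mem_Icc]
    omega
  · simp [h]

open Classical in
lemma sum_alternating_avoids1243_succ (n : ℕ) (w : ℕ → ℕ → ℕ) :
    ∑ g : Equiv.Perm (Fin (n + 3)) with IsAlternating g ∧ Avoids1243 g,
        w (inversionBound g) (bound132 g) =
      ∑ f : Equiv.Perm (Fin (n + 1)) with IsAlternating f ∧ Avoids1243 f,
        ∑ b ∈ Icc (inversionBound f) (n + 1), ∑ k ∈ Icc (bound132 f) b, w (b + 1) k :=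
  sum_filter_prependLetter_prependLetter
    (fun f => IsAlternating f ∧ Avoids1243 f) (fun g => IsAlternating g ∧ Avoids1243 g) bound132 bound132
    (fun f b => Icc (bound132 f) b) (fun f b a => if a = b then bound132 f else a + 1)
    (fun _ _ _ ha => (mem_Icc.1 ha).2)
    (fun _ _ _ => isAlternating_and_avoids1243_prependLetter_prependLetter)
    (fun _ _ _ hb ha =>
      bound132_prependLetter_prependLetter hb (mem_Icc.1 ha).2 (mem_Icc.1 ha).1)
    (fun f _ hb => bijOn_ite_succ ((bound132_le_inversionBound f).trans hb)) w

open Classical in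
lemma sum_alternating_avoids2143_succ (n : ℕ) (w : ℕ → ℕ → ℕ) :
    ∑ g : Equiv.Perm (Fin (n + 3)) with IsAlternating g ∧ Avoids2143 g,
        w (inversionBound g) (siteDefect g) =
      ∑ f : Equiv.Perm (Fin (n + 1)) with IsAlternating f ∧ Avoids2143 f,
        ∑ b ∈ Icc (inversionBound f) (n + 1), ∑ k ∈ Icc (siteDefect f) b, w (b + 1) k :=
  sum_filter_prependLetter_prependLetter
    (fun f => IsAlternating f ∧ Avoids2143 f) (fun g => IsAlternating g ∧ Avoids2143 g) siteDefect siteDefect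
    sitesUpTo (fun f b a => b + 1 - #(sitesUpTo f a))
    (fun _ _ _ ha => (mem_sitesUpTo.1 ha).1)
    (fun _ _ _ => isAlternating_and_avoids2143_prependLetter_prependLetter)
    (fun _ _ _ hb ha => siteDefect_prependLetter_prependLetter hb (mem_sitesUpTo.1 ha).1)
    (fun _ _ hb => bijOn_card_sitesUpTo hb) w

lemma bound132_perm_one (f : Equiv.Perm (Fin 1)) : bound132 f = 0 := by
  rw [← Nat.le_zero, bound132_le_iff]
  intro i j k hij
  exact absurd hij (by simp [Subsingleton.elim i j])

lemma siteDefect_perm_one (f : Equiv.Perm (Fin 1)) : siteDefect f = 0 := by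
  have h1 : inversionBound f ≤ 1 :=
    (inversionBound_le_iff f 1).2 ⟨by omega, fun _ j _ _ => (f j).2⟩
  have h2 : 0 < #(sitesUpTo f (f 0)) := card_pos.2 ⟨0, mem_sitesUpTo.2
    ⟨by omega, fun _ _ _ _ _ _ _ h => by omega⟩⟩
  rw [siteDefect]
  omega

open Classical in
lemma sum_alternating_avoids1243_eq_sum_alternating_avoids2143 (n : ℕ) (w : ℕ → ℕ → ℕ) :
    ∑ f : Equiv.Perm (Fin (2 * n + 1)) with IsAlternating f ∧ Avoids1243 f,
        w (inversionBound f) (bound132 f) =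
      ∑ f : Equiv.Perm (Fin (2 * n + 1)) with IsAlternating f ∧ Avoids2143 f,
        w (inversionBound f) (siteDefect f) := by
  -- The step applies the hypothesis to a new weight, the sum of `w` over the labels of the
  -- children.
  induction n generalizing w with
  | zero =>
    refine sum_congr ?_ fun f _ => ?_
    · ext f
      simp only [mem_filter, mem_univ, true_and]
      refine and_congr_right fun _ => ?_
      constructor <;>
      · intro _ i j k l hij
        rw [Fin.lt_def] at hij
        omega
    · rw [bound132_perm_one f, siteDefect_perm_one f]
  | succ n ih =>
    exact (sum_alternating_avoids1243_succ (2 * n) w).trans <|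
      (ih fun c m => ∑ b ∈ Icc c (2 * n + 1), ∑ k ∈ Icc m b, w (b + 1) k).trans
        (sum_alternating_avoids2143_succ (2 * n) w).symm

theorem theorem2p1 (n : ℕ) :
    (alternatingAvoiding (2 * n + 1) ![1, 2, 4, 3]).ncard =
      (alternatingAvoiding (2 * n + 1) ![2, 1, 4, 3]).ncard := by
  classical
  have h := sum_alternating_avoids1243_eq_sum_alternating_avoids2143 n fun _ _ => 1
  simp only [sum_const, smul_eq_mul, mul_one] at h
  simp only [alternatingAvoiding, not_containsPattern_1243_iff, not_containsPattern_2143_iff]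
  rw [Set.ncard_eq_toFinset_card', Set.ncard_eq_toFinset_card']
  simpa only [Set.toFinset_ofPred] using h
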